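/- Let $\mathbb{S}^2\subset\mathbb{R}^3$ be the unit sphere, let $\mu$ be the surface (Lebesgue) measure on $\mathbb{S}^2$ normalized so that $\mu(\mathbb{S}^2)=1$, and let $d(p,q)\in[0,\pi]$ be the geodesic distance. A set $S\subseteq\mathbb{S}^2$ is orthogonal-pair-free if no two points of $S$ are at distance $\frac{\pi}{2}$. A set $C\subseteq\mathbb{S}^2$ is (spherically) convex if for all $x,y\in C$ with $y\neq -x$ the geodesic segment $\overline{xy}$ (the shorter great-circle arc) lies in $C$. Let $\alpha_3$ be the supremum of $\mu(S)$ over all Lebesgue measurable orthogonal-pair-free sets $S\subseteq\mathbb{S}^2$, and let $\mathcal{A}$ be the collection of all orthogonal-pair-free sets $S\subseteq\mathbb{S}^2$ that are unions of finitely many convex sets with pairwise disjoint closures. Let $D$ be the double cap, the union of the two open geodesic discs of radius $\frac{\pi}{4}$ centred at the north and south poles; the double cap conjecture asserts $\alpha_3=\mu(D)$. Then every $S\in\mathcal{A}$ is Lebesgue measurable, and $$\alpha_3=\sup_{S\in\mathcal{A}}\mu(S).$$ Moreover $\mu(D)=1-\frac{1}{\sqrt2}$, and if the double cap conjecture is not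 true, then there exists $S\in\mathcal{A}$ with $\mu(S)>\mu(D)=1-\frac1{\sqrt2}$. -/

import Mathlib

open MeasureTheory

noncomputable section

namespace OrthFree

/-- Euclidean three-space. -/
abbrev E3 : Type := EuclideanSpace ℝ (Fin 3)

/-- The unit sphere `𝕊²` in `ℝ³`, with the subspace topology and Borel σ-algebra. -/
abbrev S2 : Type := Metric.sphere (0 : E3) 1

/-- The surface measure on `𝕊²`, normalized to total mass one. -/
def μ : Measure S2 :=
  ((volume : Measure E3).toSphere Set.univ)⁻¹ • (volume : Measure E3).toSphere

/-- The geodesic distance on `𝕊²`: the angle between the two rays from the origin. -/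
def geoDist (p q : S2) : ℝ := InnerProductGeometry.angle (p : E3) (q : E3)

/-- A set without two points at geodesic distance `π / 2`. -/
def OrthogonalPairFree (S : Set S2) : Prop :=
  ∀ p ∈ S, ∀ q ∈ S, geoDist p q ≠ Real.pi / 2

/-- The geodesic segment between two non-antipodal points `x`, `y`: the part of the sphere
in the cone spanned by `x` and `y`, that is, the shorter great-circle arc. -/
def geoSegment (x y : S2) : Set S2 :=
  {z | ∃ a b : ℝ, 0 ≤ a ∧ 0 ≤ b ∧ (z : E3) = a • (x : E3) + b • (y : E3)}

/-- Spherical convexity: the set contains the geodesic segment between any two of its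
non-antipodal points. -/
def SphericallyConvex (C : Set S2) : Prop :=
  ∀ x ∈ C, ∀ y ∈ C, (y : E3) ≠ -(x : E3) → geoSegment x y ⊆ C

/-- The collection `𝒜`: orthogonal-pair-free sets which are unions of finitely many spherically
convex sets with pairwise disjoint closures. -/
def classA : Set (Set S2) :=
  {S | OrthogonalPairFree S ∧
    ∃ (n : ℕ) (C : Fin n → Set S2),
      (∀ i, SphericallyConvex (C i)) ∧
      (∀ i j, i ≠ j → Disjoint (closure (C i)) (closure (C j))) ∧
      S = ⋃ i, C i}

/-- The supremum of the measures of all Lebesgue measurable orthogonal-pair-free sets.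
`NullMeasurableSet` is measurability for the completion of `μ`. -/
def α₃ : ENNReal := ⨆ (S : Set S2) (_ : NullMeasurableSet S μ ∧ OrthogonalPairFree S), μ S

/-- The north pole `(0, 0, 1)`. -/
def northPole : S2 := ⟨EuclideanSpace.single 2 1, by simp⟩

/-- The double cap: the two open geodesic discs of radius `π / 4` around the poles. -/
def doubleCap : Set S2 :=
  {p | geoDist northPole p < Real.pi / 4} ∪ {p | geoDist (-northPole) p < Real.pi / 4}

/-- The double cap conjecture: the supremum `α₃` is attained by the double cap. -/
def DoubleCapConjecture : Prop := α₃ = μ doubleCap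

end OrthFree

end

/-!
Spherically convex sets are the traces of convex cones on the sphere. A convex cone is null
measurable, and in polar coordinates it is the product of its trace with a ray, so the trace is
null measurable too.

An orthogonal-pair-free set is almost exhausted by a compact subset `K`, and by compactness some
thickening of `K` is still orthogonal-pair-free. Cut the sphere by finitely many great circles into
cells smaller than the thickening, and shrink each cell slightly away from the circles. The shrunken
cells meeting `K` are convex with pairwise disjoint closures, lie in the thickening, and miss little
of `K` because great circles are null.

The double cap is `{p | 1 / √2 < |p 2|}`, and it is orthogonal-pair-free by Bessel's inequality
`(p 2) ^ 2 + (q 2) ^ 2 ≤ 1` for orthogonal unit vectors `p` and `q`. Its measure follows from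
Archimedes' theorem that the zone `{p | |p 2| ≤ t}` has normalized area `t`.
-/

namespace OrthFree

open Set Metric
open scoped ENNReal NNReal Pointwise RealInnerProductSpace

section Cones

variable {E : Type*} [NormedAddCommGroup E] [NormedSpace ℝ E]

/-- A set which is invariant under positive scaling, such as a cone over a subset of the unit
sphere. The origin may or may not belong to it. -/
def IsConic (A : Set E) : Prop :=
  ∀ ⦃r : ℝ⦄, 0 < r → ∀ ⦃x⦄, x ∈ A → r • x ∈ A

theorem IsConic.smul_mem_iff {A : Set E} (hA : IsConic A) {r : ℝ} (hr : 0 < r) {x : E} :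
    r • x ∈ A ↔ x ∈ A :=
  ⟨fun h => by simpa only [inv_smul_smul₀ hr.ne'] using hA (inv_pos.2 hr) h, fun h => hA hr h⟩

theorem isConic_convexCone (K : ConvexCone ℝ E) : IsConic (K : Set E) :=
  fun _ hr _ hx => K.smul_mem hr hx

theorem isConic_submodule (p : Submodule ℝ E) : IsConic (p : Set E) :=
  fun r _ _ hx => p.smul_mem r hx

/-- The trace of a convex cone on the unit sphere. For the two-sphere these traces are exactly the
spherically convex sets, see `sphericallyConvex_iff_exists_trace_eq`. -/
def trace (K : ConvexCone ℝ E) : Set (sphere (0 : E) 1) :=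
  (↑) ⁻¹' (K : Set E)

theorem mem_trace {K : ConvexCone ℝ E} {x : sphere (0 : E) 1} : x ∈ trace K ↔ (x : E) ∈ K :=
  Iff.rfl

theorem Ioo_smul_preimage_coe {A : Set E} (hA : IsConic A) :
    Ioo (0 : ℝ) 1 • ((↑) '' ((↑) ⁻¹' A : Set (sphere (0 : E) 1)) : Set E) =
      (A ∩ ball 0 1) \ {0} := by
  ext x
  constructor
  · rintro ⟨r, ⟨hr0, hr1⟩, _, ⟨p, hp, rfl⟩, rfl⟩
    refine ⟨⟨hA hr0 hp, ?_⟩, smul_ne_zero hr0.ne' (ne_zero_of_mem_unit_sphere p)⟩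
    simpa [norm_smul, abs_of_pos hr0] using hr1
  · rintro ⟨⟨hxA, hx1⟩, hx0⟩
    have hpos : 0 < ‖x‖ := norm_pos_iff.2 hx0
    exact ⟨‖x‖, ⟨hpos, mem_ball_zero_iff.1 hx1⟩, ‖x‖⁻¹ • x,
      ⟨⟨‖x‖⁻¹ • x, by simp [norm_smul, hpos.ne']⟩, hA (inv_pos.2 hpos) hxA, rfl⟩,
      smul_inv_smul₀ hpos.ne' x⟩

end Cones

section ToSphere

variable {E : Type*} [NormedAddCommGroup E] [NormedSpace ℝ E] [FiniteDimensional ℝ E]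
  [MeasurableSpace E] [BorelSpace E] (ν : Measure E) [ν.IsAddHaarMeasure]

theorem toSphere_preimage_coe {A : Set E} (hA : IsConic A) (hAm : MeasurableSet A) :
    ν.toSphere ((↑) ⁻¹' A) = Module.finrank ℝ E * ν (A ∩ ball 0 1) := by
  nontriviality E using Module.finrank_zero_of_subsingleton
  rw [ν.toSphere_apply' (measurable_subtype_coe hAm), Ioo_smul_preimage_coe hA,
    measure_sdiff_null (measure_singleton 0)]

theorem toSphere_preimage_submodule_eq_zero {p : Submodule ℝ E} (hp : p ≠ ⊤) :
    ν.toSphere ((↑) ⁻¹' (p : Set E)) = 0 := by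
  rw [toSphere_preimage_coe ν (isConic_submodule p) p.closed_of_finiteDimensional.measurableSet,
    measure_mono_null inter_subset_left (Measure.addHaar_submodule ν p hp), mul_zero]

theorem volumeIoiPow_univ_ne_zero (n : ℕ) : Measure.volumeIoiPow n univ ≠ 0 := by
  intro h
  have h1 : Measure.volumeIoiPow n (Iio ⟨1, mem_Ioi.2 one_pos⟩) = 0 :=
    measure_mono_null (subset_univ _) h
  rw [Measure.volumeIoiPow_apply_Iio, ENNReal.ofReal_eq_zero] at h1
  exact h1.not_gt (by positivity)

theorem nullMeasurableSet_preimage_coe {A : Set E} (hA : IsConic A)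
    (hAm : NullMeasurableSet A ν) :
    NullMeasurableSet ((↑) ⁻¹' A) ν.toSphere := by
  have hpolar := ν.measurePreserving_homeomorphUnitSphereProd.symm
    (homeomorphUnitSphereProd E).toMeasurableEquiv
  have hcoe := measurePreserving_subtype_coe (μa := ν) (measurableSet_singleton (0 : E)).compl
  have hprod := (hAm.mono_ac Measure.restrict_le_self.absolutelyContinuous).preimage
    (hcoe.comp hpolar).quasiMeasurePreserving
  have heq : ((↑) ∘ (homeomorphUnitSphereProd E).toMeasurableEquiv.symm) ⁻¹' A =
      ((↑) ⁻¹' A : Set (sphere (0 : E) 1)) ×ˢ univ := by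
    ext ⟨x, r⟩
    simpa only [Homeomorph.toMeasurableEquiv_symm_coe, mem_preimage, Function.comp_apply,
      homeomorphUnitSphereProd_symm_apply_coe, mem_prod, mem_univ, and_true] using
      hA.smul_mem_iff r.2
  rw [heq] at hprod
  exact hprod.left_of_prod (volumeIoiPow_univ_ne_zero _)

theorem nullMeasurableSet_trace (K : ConvexCone ℝ E) :
    NullMeasurableSet (trace K) ν.toSphere :=
  nullMeasurableSet_preimage_coe ν (isConic_convexCone K) (K.convex.nullMeasurableSet ν)

end ToSphere

section SignCones

variable {E : Type*} [NormedAddCommGroup E] [NormedSpace ℝ E]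

/-- The separated convex unions: finite unions of traces of convex cones on the unit sphere whose
closures are pairwise disjoint. -/
def IsSeparatedConvexUnion (T : Set (sphere (0 : E) 1)) : Prop :=
  ∃ (n : ℕ) (K : Fin n → ConvexCone ℝ E),
    Pairwise (fun i j => Disjoint (closure (trace (K i))) (closure (trace (K j)))) ∧
      T = ⋃ i, trace (K i)

theorem isSeparatedConvexUnion_iUnion {ι : Type*} [Finite ι] {K : ι → ConvexCone ℝ E}
    (hK : Pairwise fun i j => Disjoint (closure (trace (K i))) (closure (trace (K j)))) :
    IsSeparatedConvexUnion (⋃ i, trace (K i)) := by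
  obtain ⟨n, ⟨e⟩⟩ := Finite.exists_equiv_fin ι
  exact ⟨n, K ∘ e.symm, hK.comp_of_injective e.symm.injective,
    (e.symm.surjective.iUnion_comp fun i => trace (K i)).symm⟩

variable {ι : Type*} {f : ι → StrongDual ℝ E} {s : ι → SignType} {η : ℝ≥0}

/-- The open cell with sign pattern `s` of the arrangement of the hyperplanes `ker (f i)`, shrunk
away from the hyperplanes: points of its trace have `η < |f i x|`. For `η = 0` it is the open cell
itself. -/
def signCone (f : ι → StrongDual ℝ E) (s : ι → SignType) (η : ℝ≥0) : ConvexCone ℝ E where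
  carrier := {x | ∀ i, η * ‖x‖ < s i * f i x}
  smul_mem' c hc x hx i := by
    rw [norm_smul_of_nonneg hc.le, map_smul, smul_eq_mul, mul_left_comm,
      mul_left_comm (s i : ℝ)]
    exact mul_lt_mul_of_pos_left (hx i) hc
  add_mem' x hx y hy i := by
    calc η * ‖x + y‖ ≤ η * ‖x‖ + η * ‖y‖ := by
          rw [← mul_add]; exact mul_le_mul_of_nonneg_left (norm_add_le x y) η.2
      _ < s i * f i x + s i * f i y := add_lt_add (hx i) (hy i)
      _ = s i * f i (x + y) := by rw [map_add, mul_add]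

theorem mem_trace_signCone {x : sphere (0 : E) 1} :
    x ∈ trace (signCone f s η) ↔ ∀ i, (η : ℝ) < s i * f i x := by
  change (∀ i, η * ‖(x : E)‖ < s i * f i x) ↔ _
  simp only [norm_eq_of_mem_sphere, mul_one]

theorem mem_trace_signCone_sign {x : sphere (0 : E) 1} :
    x ∈ trace (signCone f (fun i => SignType.sign (f i x)) η) ↔ ∀ i, η < |f i x| := by
  simp only [mem_trace_signCone, sign_mul_self]

theorem sign_eq_of_mem_closure_trace_signCone (hη : 0 < η) {x : sphere (0 : E) 1}
    (hx : x ∈ closure (trace (signCone f s η))) (i : ι) : SignType.sign (f i x) = s i := by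
  have hclosed : IsClosed {x : sphere (0 : E) 1 | (η : ℝ) ≤ s i * f i x} :=
    isClosed_le continuous_const (by fun_prop)
  have hpos : 0 < s i * f i x := (NNReal.coe_pos.2 hη).trans_le
    (closure_minimal (fun y hy => (mem_trace_signCone.1 hy i).le) hclosed hx)
  cases hs : s i <;> simp_all

theorem disjoint_closure_trace_signCone (hη : 0 < η) {t : ι → SignType} (hst : s ≠ t) :
    Disjoint (closure (trace (signCone f s η))) (closure (trace (signCone f t η))) :=
  disjoint_left.2 fun _ hs ht => hst <| funext fun i =>
    (sign_eq_of_mem_closure_trace_signCone hη hs i).symm.trans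
      (sign_eq_of_mem_closure_trace_signCone hη ht i)

/-- The union of the shrunken cells which meet `K`, used as an outer approximation of `K` off the
hyperplanes `ker (f i)`. -/
def signHull (f : ι → StrongDual ℝ E) (η : ℝ≥0) (K : Set (sphere (0 : E) 1)) :
    Set (sphere (0 : E) 1) :=
  ⋃ s : {s : ι → SignType // (K ∩ trace (signCone f s η)).Nonempty}, trace (signCone f s η)

theorem isSeparatedConvexUnion_signHull [Finite ι] (f : ι → StrongDual ℝ E) (hη : 0 < η)
    (K : Set (sphere (0 : E) 1)) : IsSeparatedConvexUnion (signHull f η K) :=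
  isSeparatedConvexUnion_iUnion fun _ _ hst =>
    disjoint_closure_trace_signCone hη (Subtype.coe_injective.ne hst)

theorem inter_subset_signHull (f : ι → StrongDual ℝ E) (η : ℝ≥0) (K : Set (sphere (0 : E) 1)) :
    K ∩ {x | ∀ i, η < |f i x|} ⊆ signHull f η K := by
  rintro x ⟨hxK, hx⟩
  have hcell := mem_trace_signCone_sign.2 hx
  exact mem_iUnion.2 ⟨⟨_, x, hxK, hcell⟩, hcell⟩

theorem signHull_subset_thickening {δ : ℝ} (hη : 0 < η)
    (hsep : ∀ x y : sphere (0 : E) 1,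
      (∀ i, SignType.sign (f i x) = SignType.sign (f i y)) → dist x y < δ)
    (K : Set (sphere (0 : E) 1)) : signHull f η K ⊆ thickening δ K := by
  intro x hx
  obtain ⟨⟨s, y, hyK, hys⟩, hxs⟩ := mem_iUnion.1 hx
  refine mem_thickening_iff.2 ⟨y, hyK, hsep x y fun i => ?_⟩
  rw [sign_eq_of_mem_closure_trace_signCone hη (subset_closure hxs),
    sign_eq_of_mem_closure_trace_signCone hη (subset_closure hys)]

theorem exists_dual_neg_pos {x y : sphere (0 : E) 1} (hxy : x ≠ y) :
    ∃ f : StrongDual ℝ E, f y < 0 ∧ 0 < f x := by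
  have h0 : (0 : E) ∉ convexHull ℝ {(x : E), -(y : E)} := by
    rw [convexHull_pair]
    rintro ⟨a, b, ha, hb, hab, h⟩
    rw [smul_neg, ← sub_eq_add_neg, sub_eq_zero] at h
    have hnorm := congrArg norm h
    simp only [norm_smul_of_nonneg ha, norm_smul_of_nonneg hb, norm_eq_of_mem_sphere,
      mul_one] at hnorm
    subst hnorm
    exact hxy (Subtype.ext (smul_right_injective E (by linarith : a ≠ 0) h))
  obtain ⟨f, u, hu, hf⟩ := geometric_hahn_banach_point_closed (convex_convexHull ℝ _)
    ((toFinite _).isClosed_convexHull ℝ) h0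
  rw [map_zero] at hu
  have hfy := hf _ (subset_convexHull ℝ _ (mem_insert_of_mem _ rfl))
  rw [map_neg] at hfy
  exact ⟨f, by linarith, hu.trans (hf _ (subset_convexHull ℝ _ (mem_insert _ _)))⟩

theorem exists_finite_dual_separating [FiniteDimensional ℝ E] {δ : ℝ} (hδ : 0 < δ) :
    ∃ F : Set (StrongDual ℝ E), F.Finite ∧ 0 ∉ F ∧ ∀ x y : sphere (0 : E) 1,
      (∀ f : F, SignType.sign (f.1 x) = SignType.sign (f.1 y)) → dist x y < δ := by
  have hcompact : IsCompact {p : sphere (0 : E) 1 × sphere (0 : E) 1 | δ ≤ dist p.1 p.2} :=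
    (isClosed_le continuous_const continuous_dist).isCompact
  obtain ⟨F, hF0, hFfin, hF⟩ := hcompact.elim_finite_subcover_image
    (b := {f : StrongDual ℝ E | f ≠ 0}) (c := fun f => {p | f p.2 < 0} ∩ {p | 0 < f p.1})
    (fun f _ => (isOpen_lt (by fun_prop) continuous_const).inter
      (isOpen_lt continuous_const (by fun_prop)))
    (by
      rintro ⟨x, y⟩ hxy
      obtain ⟨f, hy, hx⟩ := exists_dual_neg_pos (dist_pos.1 (hδ.trans_le hxy))
      refine mem_biUnion (x := f) ?_ ⟨hy, hx⟩
      rintro rfl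
      exact hx.ne' rfl)
  refine ⟨F, hFfin, fun h => hF0 h rfl, fun x y hsign => not_le.1 fun hxy => ?_⟩
  obtain ⟨f, hfF, hy, hx⟩ := mem_iUnion₂.1 (hF (show (x, y) ∈ _ from hxy))
  have := hsign ⟨f, hfF⟩
  rw [sign_pos hx, sign_neg hy] at this
  contradiction

end SignCones

section Approximation

theorem exists_thickening_prod_subset {X : Type*} [PseudoMetricSpace X] {K : Set X}
    {U : Set (X × X)} (hK : IsCompact K) (hU : IsOpen U) (hKU : K ×ˢ K ⊆ U) :
    ∃ δ, 0 < δ ∧ thickening δ K ×ˢ thickening δ K ⊆ U := by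
  obtain ⟨δ, hδ, h⟩ := (hK.prod hK).exists_thickening_subset_open hU hKU
  refine ⟨δ, hδ, fun p hp => h ?_⟩
  obtain ⟨x, hx, hpx⟩ := mem_thickening_iff.1 hp.1
  obtain ⟨y, hy, hpy⟩ := mem_thickening_iff.1 hp.2
  exact mem_thickening_iff.2 ⟨(x, y), ⟨hx, hy⟩, max_lt hpx hpy⟩

theorem exists_lt_measure_inter_lt_abs {X ι : Type*} [Finite ι] [MeasurableSpace X]
    {ν : Measure X} {g : ι → X → ℝ} (hg : ∀ i, ν {x | g i x = 0} = 0) {K : Set X} {r : ℝ≥0∞}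
    (hr : r < ν K) : ∃ η : ℝ≥0, 0 < η ∧ r < ν (K ∩ {x | ∀ i, η < |g i x|}) := by
  obtain ⟨u, hanti, hpos, hlim⟩ := exists_seq_strictAnti_tendsto (0 : ℝ≥0)
  have hmono : Monotone fun n => K ∩ {x | ∀ i, (u n : ℝ) < |g i x|} := fun m n hmn x hx =>
    ⟨hx.1, fun i => (NNReal.coe_le_coe.2 (hanti.antitone hmn)).trans_lt (hx.2 i)⟩
  have hcover : K \ (⋃ i, {x | g i x = 0}) ⊆ ⋃ n, K ∩ {x | ∀ i, (u n : ℝ) < |g i x|} := by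
    rintro x ⟨hxK, hx⟩
    simp only [mem_iUnion, not_exists] at hx
    have hlim' : Filter.Tendsto (fun n => (u n : ℝ)) Filter.atTop (nhds 0) :=
      NNReal.tendsto_coe.2 hlim
    obtain ⟨n, hn⟩ := (Filter.eventually_all.2 fun i =>
      hlim'.eventually_lt_const (abs_pos.2 (hx i))).exists
    exact mem_iUnion.2 ⟨n, hxK, hn⟩
  rw [← measure_sdiff_null (measure_iUnion_null hg)] at hr
  obtain ⟨n, hn⟩ := lt_iSup_iff.1 (hmono.measure_iUnion ▸ hr.trans_le (measure_mono hcover))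
  exact ⟨u n, hpos n, hn⟩

variable {E : Type*} [NormedAddCommGroup E] [NormedSpace ℝ E] [FiniteDimensional ℝ E]
  [MeasurableSpace E] [BorelSpace E]

theorem exists_isSeparatedConvexUnion_lt_measure {ν : Measure (sphere (0 : E) 1)}
    [IsFiniteMeasure ν] (hν : ∀ f : StrongDual ℝ E, f ≠ 0 → ν {x | f x = 0} = 0)
    {U : Set (sphere (0 : E) 1 × sphere (0 : E) 1)} (hU : IsOpen U) {S : Set (sphere (0 : E) 1)}
    (hS : NullMeasurableSet S ν) (hSU : S ×ˢ S ⊆ U) {r : ℝ≥0∞} (hr : r < ν S) :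
    ∃ T, IsSeparatedConvexUnion T ∧ T ×ˢ T ⊆ U ∧ r < ν T := by
  obtain ⟨S', hS'S, hS'm, hS'ae⟩ := hS.exists_measurable_subset_ae_eq
  obtain ⟨K, hKS', hK, hrK⟩ := hS'm.exists_lt_isCompact (measure_congr hS'ae ▸ hr)
  have hKS : K ⊆ S := hKS'.trans hS'S
  obtain ⟨δ, hδ, hδU⟩ := exists_thickening_prod_subset hK hU ((prod_mono hKS hKS).trans hSU)
  obtain ⟨F, hFfin, hF0, hsep⟩ := exists_finite_dual_separating (E := E) hδ
  have := hFfin.to_subtype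
  obtain ⟨η, hη, hrη⟩ := exists_lt_measure_inter_lt_abs
    (fun f : F => hν f (ne_of_mem_of_not_mem f.2 hF0)) hrK
  have hsub := signHull_subset_thickening hη hsep K
  exact ⟨signHull (fun f : F => f.1) η K, isSeparatedConvexUnion_signHull _ hη K,
    (prod_mono hsub hsub).trans hδU,
    hrη.trans_le (measure_mono (inter_subset_signHull _ η K))⟩

end Approximation

section NormalizedMeasure

instance : IsProbabilityMeasure μ := by
  have : NeZero (volume : Measure E3).toSphere := ⟨Measure.toSphere_ne_zero volume⟩
  exact isProbabilityMeasureSMul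

theorem μ_preimage_coe {A : Set E3} (hA : IsConic A) (hAm : MeasurableSet A) :
    μ ((↑) ⁻¹' A) = volume (A ∩ ball 0 1) / volume (ball (0 : E3) 1) := by
  rw [μ, Measure.smul_apply, smul_eq_mul, Measure.toSphere_apply_univ,
    toSphere_preimage_coe volume hA hAm, mul_comm, ← div_eq_mul_inv,
    ENNReal.mul_div_mul_left _ _ (by simp) (by simp)]

theorem μ_dual_eq_zero {f : StrongDual ℝ E3} (hf : f ≠ 0) : μ {x : S2 | f x = 0} = 0 := by
  refine mul_eq_zero_of_right _ (toSphere_preimage_submodule_eq_zero volume (p := f.ker) ?_)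
  exact fun h => hf (ContinuousLinearMap.coe_injective (LinearMap.ker_eq_top.1 h))

end NormalizedMeasure

section SphericalConvexity

variable {C S : Set S2}

theorem SphericallyConvex.exists_smul_add_smul_eq (hC : SphericallyConvex C) {x y : S2}
    (hx : x ∈ C) (hy : y ∈ C) {a b : ℝ} (ha : 0 ≤ a) (hb : 0 ≤ b) :
    ∃ r : ℝ, 0 ≤ r ∧ ∃ z ∈ C, a • (x : E3) + b • (y : E3) = r • (z : E3) := by
  by_cases hxy : (y : E3) = -x
  · rcases le_total b a with hba | hab
    · exact ⟨a - b, sub_nonneg.2 hba, x, hx, by rw [hxy]; module⟩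
    · exact ⟨b - a, sub_nonneg.2 hab, y, hy, by rw [hxy]; module⟩
  set w : E3 := a • (x : E3) + b • (y : E3) with hw
  rcases eq_or_ne w 0 with h0 | h0
  · exact ⟨0, le_rfl, x, hx, by rw [h0, zero_smul]⟩
  · have hnorm : ‖w‖ ≠ 0 := norm_ne_zero_iff.2 h0
    refine ⟨‖w‖, norm_nonneg w, ⟨‖w‖⁻¹ • w, by simp [norm_smul, hnorm]⟩,
      hC x hx y hy hxy ⟨‖w‖⁻¹ * a, ‖w‖⁻¹ * b, by positivity, by positivity, ?_⟩,
      (smul_inv_smul₀ hnorm w).symm⟩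
    simp only [hw, smul_add, mul_smul]

/-- The convex cone over a spherically convex set. The radius `r = 0` is allowed, since the set may
contain antipodal points. -/
def SphericallyConvex.cone (hC : SphericallyConvex C) : ConvexCone ℝ E3 where
  carrier := {x | ∃ r : ℝ, 0 ≤ r ∧ ∃ c ∈ C, x = r • (c : E3)}
  smul_mem' := by
    rintro a ha _ ⟨r, hr, c, hc, rfl⟩
    exact ⟨a * r, by positivity, c, hc, (mul_smul a r (c : E3)).symm⟩
  add_mem' := by
    rintro _ ⟨r, hr, c, hc, rfl⟩ _ ⟨s, hs, d, hd, rfl⟩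
    exact hC.exists_smul_add_smul_eq hc hd hr hs

theorem SphericallyConvex.trace_cone (hC : SphericallyConvex C) : trace hC.cone = C := by
  refine Subset.antisymm ?_ fun x hx => ⟨1, zero_le_one, x, hx, (one_smul ℝ (x : E3)).symm⟩
  rintro x ⟨r, hr, c, hc, h⟩
  have hr1 : r = 1 := by
    simpa [norm_smul_of_nonneg hr, eq_comm] using congrArg norm h
  rwa [Subtype.ext (h.trans (by rw [hr1, one_smul]))]

theorem sphericallyConvex_trace (K : ConvexCone ℝ E3) : SphericallyConvex (trace K) := by
  rintro x hx y hy - z ⟨a, b, ha, hb, hz⟩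
  rw [mem_trace, hz]
  rcases ha.eq_or_lt with rfl | ha
  · rcases hb.eq_or_lt with rfl | hb
    · exact absurd (by simpa using hz) (ne_zero_of_mem_unit_sphere z)
    · simpa using K.smul_mem hb hy
  · rcases hb.eq_or_lt with rfl | hb
    · simpa using K.smul_mem ha hx
    · exact K.add_mem (K.smul_mem ha hx) (K.smul_mem hb hy)

theorem sphericallyConvex_iff_exists_trace_eq :
    SphericallyConvex C ↔ ∃ K : ConvexCone ℝ E3, trace K = C :=
  ⟨fun hC => ⟨hC.cone, hC.trace_cone⟩, fun ⟨K, hK⟩ => hK ▸ sphericallyConvex_trace K⟩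

theorem mem_classA_iff : S ∈ classA ↔ OrthogonalPairFree S ∧ IsSeparatedConvexUnion S := by
  refine and_congr_right fun _ => ⟨?_, ?_⟩
  · rintro ⟨n, C, hC, hdisj, rfl⟩
    choose K hK using fun i => sphericallyConvex_iff_exists_trace_eq.1 (hC i)
    obtain rfl : (fun i => trace (K i)) = C := funext hK
    exact ⟨n, K, fun i j => hdisj i j, rfl⟩
  · rintro ⟨n, K, hdisj, hS⟩
    exact ⟨n, fun i => trace (K i), fun i => sphericallyConvex_trace (K i),
      fun _ _ hij => hdisj hij, hS⟩

theorem IsSeparatedConvexUnion.nullMeasurableSet (hS : IsSeparatedConvexUnion S) :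
    NullMeasurableSet S μ := by
  obtain ⟨n, K, -, rfl⟩ := hS
  exact .iUnion fun i => (nullMeasurableSet_trace volume (K i)).smul_measure _

theorem nullMeasurableSet_of_mem_classA (hS : S ∈ classA) : NullMeasurableSet S μ :=
  (mem_classA_iff.1 hS).2.nullMeasurableSet

theorem orthogonalPairFree_iff_prod_subset :
    OrthogonalPairFree S ↔ S ×ˢ S ⊆ {p : S2 × S2 | ⟪(p.1 : E3), (p.2 : E3)⟫ ≠ 0} := by
  simp only [OrthogonalPairFree, geoDist, prod_subset_iff, mem_ofPred_eq, ne_eq,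
    InnerProductGeometry.inner_eq_zero_iff_angle_eq_pi_div_two]

theorem exists_classA_lt_measure (hS : NullMeasurableSet S μ) (hfree : OrthogonalPairFree S)
    {r : ℝ≥0∞} (hr : r < μ S) : ∃ T ∈ classA, r < μ T := by
  have hopen : IsOpen {p : S2 × S2 | ⟪(p.1 : E3), (p.2 : E3)⟫ ≠ 0} :=
    isOpen_ne_fun (by fun_prop) continuous_const
  obtain ⟨T, hT, hTfree, hlt⟩ := exists_isSeparatedConvexUnion_lt_measure
    (fun _ => μ_dual_eq_zero) hopen hS (orthogonalPairFree_iff_prod_subset.1 hfree) hr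
  exact ⟨T, mem_classA_iff.2 ⟨orthogonalPairFree_iff_prod_subset.2 hTfree, hT⟩, hlt⟩

theorem α₃_eq_iSup_classA : α₃ = ⨆ S ∈ classA, μ S := by
  refine le_antisymm (iSup₂_le fun S hS => le_of_forall_lt fun r hr => ?_)
    (iSup₂_le fun S hS => le_iSup₂_of_le S ⟨nullMeasurableSet_of_mem_classA hS, hS.1⟩ le_rfl)
  obtain ⟨T, hT, hlt⟩ := exists_classA_lt_measure hS.1 hS.2 hr
  exact hlt.trans_le (le_iSup₂_of_le T hT le_rfl)

end SphericalConvexity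

section HatBox

theorem volume_disc (m : ℝ) :
    volume {y : Fin 2 → ℝ | y 0 ^ 2 + y 1 ^ 2 < m} = ENNReal.ofReal m * ENNReal.ofReal Real.pi := by
  have h : WithLp.toLp 2 ⁻¹' ball (0 : EuclideanSpace ℝ (Fin 2)) √m =
      {y : Fin 2 → ℝ | y 0 ^ 2 + y 1 ^ 2 < m} := by
    ext y
    simp [Real.lt_sqrt, EuclideanSpace.norm_sq_eq, Fin.sum_univ_two]
  rw [← h, (PiLp.volume_preserving_toLp (Fin 2)).measure_preimage
    measurableSet_ball.nullMeasurableSet, EuclideanSpace.volume_ball_fin_two,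
    ← ENNReal.ofReal_pow (Real.sqrt_nonneg m), Real.sq_sqrt', ENNReal.ofReal_max]
  simp

theorem volume_annulus {a : ℝ} (ha : 0 ≤ a) (b : ℝ) :
    volume {y : Fin 2 → ℝ | a ≤ y 0 ^ 2 + y 1 ^ 2 ∧ y 0 ^ 2 + y 1 ^ 2 < b} =
      ENNReal.ofReal (b - a) * ENNReal.ofReal Real.pi := by
  have hsdiff : {y : Fin 2 → ℝ | a ≤ y 0 ^ 2 + y 1 ^ 2 ∧ y 0 ^ 2 + y 1 ^ 2 < b} =
      {y | y 0 ^ 2 + y 1 ^ 2 < b} \ {y | y 0 ^ 2 + y 1 ^ 2 < a} := by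
    ext y
    simp [and_comm]
  have hmono {c d : ℝ} (hcd : c ≤ d) :
      {y : Fin 2 → ℝ | y 0 ^ 2 + y 1 ^ 2 < c} ⊆ {y | y 0 ^ 2 + y 1 ^ 2 < d} :=
    fun _ hy => hy.trans_le hcd
  rcases le_total b a with hba | hab
  · rw [hsdiff, sdiff_eq_empty.2 (hmono hba), measure_empty,
      ENNReal.ofReal_of_nonpos (sub_nonpos.2 hba), zero_mul]
  · have hfin : volume {y : Fin 2 → ℝ | y 0 ^ 2 + y 1 ^ 2 < a} ≠ ∞ := by
      rw [volume_disc]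
      exact ENNReal.mul_ne_top ENNReal.ofReal_ne_top ENNReal.ofReal_ne_top
    rw [hsdiff, measure_sdiff (hmono hab)
      (isOpen_lt (by fun_prop) continuous_const).nullMeasurableSet hfin, volume_disc, volume_disc,
      ← ENNReal.sub_mul fun _ _ => ENNReal.ofReal_ne_top, ENNReal.ofReal_sub b ha]

theorem volume_annular_slices {a b : ℝ → ℝ} (ha : Measurable a) (hb : Measurable b)
    (ha0 : ∀ z, 0 ≤ a z) :
    volume {x : E3 | a (x 2) ≤ x 0 ^ 2 + x 1 ^ 2 ∧ x 0 ^ 2 + x 1 ^ 2 < b (x 2)} =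
      (∫⁻ z, ENNReal.ofReal (b z - a z)) * ENNReal.ofReal Real.pi := by
  let T : Set (ℝ × (Fin 2 → ℝ)) :=
    {w | a w.1 ≤ w.2 0 ^ 2 + w.2 1 ^ 2} ∩ {w | w.2 0 ^ 2 + w.2 1 ^ 2 < b w.1}
  have hT : MeasurableSet T := (measurableSet_le (by fun_prop) (by fun_prop)).inter
    (measurableSet_lt (by fun_prop) (by fun_prop))
  have hmp := (volume_preserving_piFinSuccAbove (fun _ : Fin 3 => ℝ) 2).comp
    (PiLp.volume_preserving_ofLp (Fin 3))
  calc volume {x : E3 | a (x 2) ≤ x 0 ^ 2 + x 1 ^ 2 ∧ x 0 ^ 2 + x 1 ^ 2 < b (x 2)}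
      = volume T := hmp.measure_preimage hT.nullMeasurableSet
    _ = ∫⁻ z, volume (Prod.mk z ⁻¹' T) := Measure.prod_apply hT
    _ = ∫⁻ z, ENNReal.ofReal (b z - a z) * ENNReal.ofReal Real.pi :=
        lintegral_congr fun z => volume_annulus (ha0 z) (b z)
    _ = _ := lintegral_mul_const _ (by fun_prop)

theorem lintegral_comp_inv_mul {f : ℝ → ℝ≥0∞} (hf : Measurable f) {t : ℝ} (ht : 0 < t) :
    ∫⁻ z, f (t⁻¹ * z) = ENNReal.ofReal t * ∫⁻ z, f z := by
  rw [← lintegral_map hf (by fun_prop), Real.map_volume_mul_left (inv_ne_zero ht.ne'), inv_inv,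
    abs_of_pos ht, lintegral_smul_measure, smul_eq_mul]

theorem norm_sq_eq_add (x : E3) : ‖x‖ ^ 2 = x 0 ^ 2 + x 1 ^ 2 + x 2 ^ 2 := by
  simp [EuclideanSpace.norm_sq_eq, Fin.sum_univ_three]

/- The slice of the cone at height `z` and the slice of the ball at height `z / t` have the same
area `π * (1 - (z / t) ^ 2)`. -/
theorem volume_zonalCone {t : ℝ} (ht0 : 0 < t) (ht1 : t ≤ 1) :
    volume ({x : E3 | |x 2| ≤ t * ‖x‖} ∩ ball 0 1) =
      ENNReal.ofReal t * ((∫⁻ z, ENNReal.ofReal (1 - z ^ 2)) * ENNReal.ofReal Real.pi) := by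
  have hslices : {x : E3 | |x 2| ≤ t * ‖x‖} ∩ ball 0 1 =
      {x : E3 | (t⁻¹ ^ 2 - 1) * x 2 ^ 2 ≤ x 0 ^ 2 + x 1 ^ 2 ∧
        x 0 ^ 2 + x 1 ^ 2 < 1 - x 2 ^ 2} := by
    ext x
    have hcone : |x 2| ≤ t * ‖x‖ ↔ (t⁻¹ ^ 2 - 1) * x 2 ^ 2 ≤ x 0 ^ 2 + x 1 ^ 2 := by
      rw [← inv_mul_le_iff₀ ht0, ← sq_le_sq₀ (by positivity) (norm_nonneg x), mul_pow, sq_abs,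
        norm_sq_eq_add, sub_one_mul, sub_le_iff_le_add]
    have hball : ‖x‖ < 1 ↔ x 0 ^ 2 + x 1 ^ 2 < 1 - x 2 ^ 2 := by
      rw [← sq_lt_one_iff₀ (norm_nonneg x), norm_sq_eq_add, lt_sub_iff_add_lt]
    rw [mem_inter_iff, mem_ball_zero_iff, hball]
    exact and_congr_left fun _ => hcone
  have hinv : 1 ≤ t⁻¹ ^ 2 := one_le_pow₀ ((one_le_inv₀ ht0).2 ht1)
  rw [hslices, volume_annular_slices (a := fun z => (t⁻¹ ^ 2 - 1) * z ^ 2)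
    (b := fun z => 1 - z ^ 2) (by fun_prop) (by fun_prop)
    fun z => mul_nonneg (sub_nonneg.2 hinv) (sq_nonneg z), ← mul_assoc,
    ← lintegral_comp_inv_mul (by fun_prop) ht0]
  congr 1
  exact lintegral_congr fun z => by ring_nf

theorem volume_zonalCone_eq_mul {t : ℝ} (ht0 : 0 < t) (ht1 : t ≤ 1) :
    volume ({x : E3 | |x 2| ≤ t * ‖x‖} ∩ ball 0 1) =
      ENNReal.ofReal t * volume (ball (0 : E3) 1) := by
  have hball : {x : E3 | |x 2| ≤ 1 * ‖x‖} ∩ ball 0 1 = ball 0 1 :=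
    inter_eq_right.2 fun x _ => (PiLp.norm_apply_le x 2).trans_eq (one_mul _).symm
  have hunit := volume_zonalCone one_pos le_rfl
  rw [hball, ENNReal.ofReal_one, one_mul] at hunit
  rw [volume_zonalCone ht0 ht1, hunit]

theorem μ_zone {t : ℝ} (ht0 : 0 < t) (ht1 : t ≤ 1) :
    μ {p : S2 | |(p : E3) 2| ≤ t} = ENNReal.ofReal t := by
  have hconic : IsConic {x : E3 | |x 2| ≤ t * ‖x‖} := fun r hr x hx => by
    simpa [norm_smul, abs_mul, abs_of_pos hr, mul_left_comm t] using
      mul_le_mul_of_nonneg_left hx hr.le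
  have hmeas : MeasurableSet {x : E3 | |x 2| ≤ t * ‖x‖} :=
    (isClosed_le (by fun_prop) (by fun_prop)).measurableSet
  have htrace : {p : S2 | |(p : E3) 2| ≤ t} = (↑) ⁻¹' {x : E3 | |x 2| ≤ t * ‖x‖} := by
    ext p
    simp
  rw [htrace, μ_preimage_coe hconic hmeas, volume_zonalCone_eq_mul ht0 ht1]
  exact ENNReal.mul_div_cancel_right (measure_ball_pos _ _ one_pos).ne' measure_ball_lt_top.ne

theorem measurableSet_zone (t : ℝ) : MeasurableSet {p : S2 | |(p : E3) 2| ≤ t} :=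
  (isClosed_le (by fun_prop) continuous_const).measurableSet

end HatBox

section DoubleCap

theorem inner_sq_add_inner_sq_le_norm_sq {E : Type*} [NormedAddCommGroup E]
    [InnerProductSpace ℝ E] {p q : E} (hp : ‖p‖ = 1) (hq : ‖q‖ = 1) (hpq : ⟪p, q⟫ = 0) (x : E) :
    ⟪p, x⟫ ^ 2 + ⟪q, x⟫ ^ 2 ≤ ‖x‖ ^ 2 := by
  have horth : Orthonormal ℝ ![p, q] := by simp [hp, hq, hpq]
  simpa using horth.sum_inner_products_le (s := Finset.univ) x

theorem geoDist_lt_iff {p q : S2} {r : ℝ} (h0 : 0 ≤ r) (hπ : r ≤ Real.pi) :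
    geoDist p q < r ↔ Real.cos r < ⟪(p : E3), (q : E3)⟫ := by
  rw [geoDist, ← Real.strictAntiOn_cos.lt_iff_gt ⟨h0, hπ⟩
    ⟨InnerProductGeometry.angle_nonneg _ _, InnerProductGeometry.angle_le_pi _ _⟩,
    InnerProductGeometry.cos_angle]
  simp only [norm_eq_of_mem_sphere, mul_one, div_one]

theorem inner_northPole (p : S2) : ⟪(p : E3), (northPole : E3)⟫ = (p : E3) 2 := by
  simp [northPole, EuclideanSpace.inner_single_right]

theorem mem_doubleCap_iff {p : S2} : p ∈ doubleCap ↔ 1 / √2 < |(p : E3) 2| := by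
  have hpi := Real.pi_pos
  rw [doubleCap, mem_union, mem_ofPred_eq, mem_ofPred_eq,
    geoDist_lt_iff (by linarith) (by linarith), geoDist_lt_iff (by linarith) (by linarith),
    coe_neg_sphere, inner_neg_left, real_inner_comm, inner_northPole, Real.cos_pi_div_four,
    Real.sqrt_div_self', lt_abs]

theorem orthogonalPairFree_doubleCap : OrthogonalPairFree doubleCap := by
  rw [orthogonalPairFree_iff_prod_subset]
  rintro ⟨p, q⟩ ⟨hp, hq⟩ hpq
  have hhalf {x : S2} (hx : x ∈ doubleCap) : 1 / 2 < (x : E3) 2 ^ 2 := by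
    have h := pow_lt_pow_left₀ (mem_doubleCap_iff.1 hx) (by positivity) two_ne_zero
    rwa [div_pow, one_pow, Real.sq_sqrt zero_le_two, sq_abs] at h
  have hbessel := inner_sq_add_inner_sq_le_norm_sq (norm_eq_of_mem_sphere p)
    (norm_eq_of_mem_sphere q) hpq (northPole : E3)
  rw [inner_northPole, inner_northPole, norm_eq_of_mem_sphere] at hbessel
  linarith [hhalf hp, hhalf hq]

theorem doubleCap_eq_compl_zone : doubleCap = {p : S2 | |(p : E3) 2| ≤ 1 / √2}ᶜ := by
  ext p
  rw [mem_doubleCap_iff, mem_compl_iff, mem_ofPred_eq, not_le]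

theorem measurableSet_doubleCap : MeasurableSet doubleCap :=
  doubleCap_eq_compl_zone ▸ (measurableSet_zone _).compl

theorem μ_doubleCap : μ doubleCap = ENNReal.ofReal (1 - 1 / √2) := by
  have hle : 1 / √2 ≤ 1 := div_le_one_of_le₀ (Real.one_le_sqrt.2 one_le_two) (Real.sqrt_nonneg 2)
  rw [doubleCap_eq_compl_zone, prob_compl_eq_one_sub (measurableSet_zone _),
    μ_zone (by positivity) hle, ENNReal.ofReal_sub 1 (by positivity), ENNReal.ofReal_one]

theorem μ_doubleCap_le_α₃ : μ doubleCap ≤ α₃ :=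
  le_iSup₂_of_le doubleCap
    ⟨measurableSet_doubleCap.nullMeasurableSet, orthogonalPairFree_doubleCap⟩ le_rfl

theorem exists_classA_doubleCap_lt (h : ¬ DoubleCapConjecture) :
    ∃ S ∈ classA, μ doubleCap < μ S := by
  have hlt : μ doubleCap < α₃ := μ_doubleCap_le_α₃.lt_of_ne' h
  simpa only [α₃_eq_iSup_classA, lt_iSup_iff, exists_prop] using hlt

end DoubleCap

end OrthFree

theorem theorem1 :
    (∀ S ∈ OrthFree.classA, NullMeasurableSet S OrthFree.μ) ∧
    (OrthFree.α₃ = ⨆ S ∈ OrthFree.classA, OrthFree.μ S) ∧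
    OrthFree.μ OrthFree.doubleCap = ENNReal.ofReal (1 - 1 / Real.sqrt 2) ∧
    (¬ OrthFree.DoubleCapConjecture →
      ∃ S ∈ OrthFree.classA, OrthFree.μ OrthFree.doubleCap < OrthFree.μ S) :=
  ⟨fun _ => OrthFree.nullMeasurableSet_of_mem_classA, OrthFree.α₃_eq_iSup_classA,
    OrthFree.μ_doubleCap, OrthFree.exists_classA_doubleCap_lt⟩
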